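/- For real $y$ and an integer $n\ge 1$ let $\omega_y(n)$ be the number of distinct primes $p\mid n$ with $p<y$. For $z\in\mathbb{C}$ and real $x\ge y\ge 3$ put $$S_z(x,y)=\sum_{1\le n\le x} z^{\omega_y(n)}\quad(\text{with }0^0=1),\qquad M_z(x,y)=x\prod_{p<y}\Bigl(1+\frac{z-1}{p}\Bigr),\qquad \alpha=\frac{\log x}{\log y},$$ the product being over primes $p<y$. **Theorem.** There is an absolute constant $C_1>0$ such that for every $R>0$ there is a constant $D>0$, depending only on $R$, with the following properties. (1) There is a constant $C_2>0$ depending only on $R$ such that for all $z\in\mathbb{C}$ with $|z|\le R$ and all $x\ge y\ge 3$, $$\bigl|S_z(x,y)-M_z(x,y)\bigr|\le C_1\,x e^{-\alpha}(\log x)^{D}+C_2\,\frac{x}{(\log x)^{R+2}}.$$ (2) For every $\varepsilon>0$ there is a constant $C_3>0$ depending only on $R$ and $\varepsilon$ such that for all $|z|\le R$ and all $x\ge y\ge 3$ with $\alpha\ge (R+D+1+\varepsilon)\log\log x$, $$\bigl|S_z(x,y)-M_z(x,y)\bigr|\le C_3\,\frac{x}{(\log y)^{R+1+\varepsilon}}.$$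 (3) There is a constant $K>0$ depending only on $R$ such that for each fixed $z\in\mathbb{C}$ with $|z|\le R$, $z\ne 1$, and $z\ne 1-p$ for every prime $p$, $$S_z(x,y)\sim M_z(x,y)$$ as $x\to\infty$, uniformly in $y$ subject to $3\le y\le x$ and $\alpha\ge K\log\log x$. -/

import Mathlib

/-- `omegaBelow y n` is the number of distinct primes `p ∣ n` with `p < y` (for `n ≥ 1`). -/
noncomputable def omegaBelow (y : ℝ) (n : ℕ) : ℕ :=
  (n.primeFactors.filter fun p : ℕ => (p : ℝ) < y).card

/-- The sum of `z ^ omegaBelow y n` over the positive integers `n ≤ x`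
(with the convention `0 ^ 0 = 1`). -/
noncomputable def omegaSum (z : ℂ) (x y : ℝ) : ℂ :=
  ∑ n ∈ Finset.Icc 1 ⌊x⌋₊, z ^ omegaBelow y n

/-- The finite set of primes `p < y`. -/
noncomputable def primesLT (y : ℝ) : Finset ℕ :=
  Nat.primesBelow ⌈y⌉₊

theorem mem_primesLT (y : ℝ) (p : ℕ) : p ∈ primesLT y ↔ p.Prime ∧ (p : ℝ) < y := by
  rw [primesLT, Nat.mem_primesBelow, Nat.lt_ceil, and_comm]

/-- The main term `x * ∏_{p < y} (1 + (z - 1) / p)`. -/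
noncomputable def omegaMain (z : ℂ) (x y : ℝ) : ℂ :=
  (x : ℂ) * ∏ p ∈ primesLT y, (1 + (z - 1) / (p : ℂ))

/-- The parameter `α = log x / log y`. -/
noncomputable def alphaParam (x y : ℝ) : ℝ :=
  Real.log x / Real.log y

open Filter Asymptotics Finset

/-! Expanding `z ^ omegaBelow y n` as a product of `1 + (z - 1) * 1_{p ∣ n}` turns both sum and main
term into sums over the same squarefree `d` built from primes below `y`, with `⌊x / d⌋` against `x /
d`. Rankin's trick bounds each discrepancy by `(x / d) ^ σ`; with `σ = 1 - 1 / log y` the total is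
at most `x * e ^ (-α)` times an Euler product, which Mertens' upper bound makes at most a power of
`log x` (`norm_omegaSum_sub_omegaMain_le`). This already gives (1) without its second error term,
and (2) once `α` is large. For (3) the main term is bounded below by `x` times a negative power of
`log x` (`exists_le_norm_omegaMain`). -/

theorem sum_inv_primesBelow_two_pow_le (K : ℕ) :
    ∑ p ∈ Nat.primesBelow (2 ^ (K + 1)), (p : ℝ)⁻¹ ≤ 4 * (harmonic K : ℝ) := by
  induction K with
  | zero => simp
  | succ K ih =>
    have hl : 0 < Real.log 2 := Real.log_pos one_lt_two
    -- On a dyadic block `1 / p` is at most `log p / (2 ^ (K + 1) * (K + 1) * log 2)`, and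
    -- Chebyshev's bound on `θ` sums the logarithms.
    have hblock : ∑ p ∈ Ico ((2 : ℕ) ^ (K + 1)) (2 ^ (K + 2)) with p.Prime, (p : ℝ)⁻¹
        ≤ 4 * ((K : ℝ) + 1)⁻¹ := by
      have h1 : ∑ p ∈ Ico ((2 : ℕ) ^ (K + 1)) (2 ^ (K + 2)) with p.Prime, Real.log p
          ≤ Chebyshev.theta ((2 ^ (K + 2) : ℕ) : ℝ) := by
        rw [Chebyshev.theta_eq_sum_primesLE_log]
        refine sum_le_sum_of_subset_of_nonneg ?_ fun p hp _ => Real.log_natCast_nonneg p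
        intro p hp
        simp only [mem_filter, mem_Ico] at hp
        exact Nat.mem_primesLE.2 ⟨hp.1.2.le, hp.2⟩
      have h2 := Chebyshev.theta_le_log4_mul_x (x := ((2 ^ (K + 2) : ℕ) : ℝ)) (by positivity)
      have h4 : Real.log 4 = 2 * Real.log 2 := by
        rw [show (4 : ℝ) = 2 ^ 2 by norm_num, Real.log_pow]; norm_num
      have hterm : ∀ p ∈ {p ∈ Ico ((2 : ℕ) ^ (K + 1)) (2 ^ (K + 2)) | p.Prime}, (p : ℝ)⁻¹ ≤
          ((2 : ℝ) ^ (K + 1))⁻¹ * (((K : ℝ) + 1) * Real.log 2)⁻¹ * Real.log p := by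
        intro p hp
        simp only [mem_filter, mem_Ico] at hp
        have hp1 : (2 : ℝ) ^ (K + 1) ≤ p := by exact_mod_cast hp.1.1
        have hlog : ((K : ℝ) + 1) * Real.log 2 ≤ Real.log p := by
          have := Real.log_le_log (by positivity) hp1
          rw [Real.log_pow] at this
          exact_mod_cast this
        have hpos : 0 < ((K : ℝ) + 1) * Real.log 2 := by positivity
        calc (p : ℝ)⁻¹ ≤ ((2 : ℝ) ^ (K + 1))⁻¹ * 1 := by
              rw [mul_one]; exact inv_anti₀ (by positivity) hp1
          _ ≤ ((2 : ℝ) ^ (K + 1))⁻¹ * ((((K : ℝ) + 1) * Real.log 2)⁻¹ * Real.log p) := by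
              gcongr
              rw [inv_mul_eq_div, one_le_div hpos]
              exact hlog
          _ = _ := by ring
      calc _ ≤ _ := sum_le_sum hterm
        _ = ((2 : ℝ) ^ (K + 1))⁻¹ * (((K : ℝ) + 1) * Real.log 2)⁻¹ *
            ∑ p ∈ Ico ((2 : ℕ) ^ (K + 1)) (2 ^ (K + 2)) with p.Prime, Real.log p := by rw [mul_sum]
        _ ≤ ((2 : ℝ) ^ (K + 1))⁻¹ * (((K : ℝ) + 1) * Real.log 2)⁻¹ *
            (Real.log 4 * ((2 ^ (K + 2) : ℕ) : ℝ)) := by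
              gcongr
              exact h1.trans h2
        _ = 4 * ((K : ℝ) + 1)⁻¹ := by
              rw [h4]; push_cast; field_simp; ring
    have hsplit : ∑ p ∈ Nat.primesBelow (2 ^ (K + 1 + 1)), (p : ℝ)⁻¹ =
        ∑ p ∈ Nat.primesBelow (2 ^ (K + 1)), (p : ℝ)⁻¹ +
        ∑ p ∈ Ico ((2 : ℕ) ^ (K + 1)) (2 ^ (K + 2)) with p.Prime, (p : ℝ)⁻¹ := by
      simp only [Nat.primesBelow, sum_filter, range_eq_Ico]
      exact (sum_Ico_consecutive _ (Nat.zero_le _)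
        (Nat.pow_le_pow_right two_pos (Nat.le_succ _))).symm
    rw [hsplit, harmonic_succ]
    push_cast
    linarith

theorem log_log_pos {y : ℝ} (hy : 3 ≤ y) : 0 < Real.log (Real.log 3) ∧
    Real.log (Real.log 3) ≤ Real.log (Real.log y) := by
  have h3 : 1 < Real.log 3 := by
    rw [Real.lt_log_iff_exp_lt (by norm_num)]
    exact Real.exp_one_lt_three
  exact ⟨Real.log_pos h3, Real.log_le_log (by linarith) (Real.log_le_log (by norm_num) hy)⟩

theorem one_lt_log {y : ℝ} (hy : 3 ≤ y) : 1 < Real.log y := by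
  rw [Real.lt_log_iff_exp_lt (by linarith)]
  linarith [Real.exp_one_lt_three]

/-- Mertens' upper bound for the sum of the reciprocals of the primes, up to a constant. -/
theorem exists_sum_inv_primesLT_le :
    ∃ A : ℝ, 0 < A ∧ ∀ y : ℝ, 3 ≤ y →
      ∑ p ∈ primesLT y, (p : ℝ)⁻¹ ≤ A * Real.log (Real.log y) := by
  obtain ⟨hc, -⟩ := log_log_pos le_rfl
  set c := Real.log (Real.log 3)
  -- The dyadic bound gives `4 * log log y + 8`; the `8` is absorbed using `c ≤ log log y`.
  refine ⟨4 + 8 / c, by positivity, fun y hy => ?_⟩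
  have hcy : c ≤ Real.log (Real.log y) := (log_log_pos hy).2
  have hl : 0 < Real.log 2 := Real.log_pos one_lt_two
  have hly := one_lt_log hy
  set t := Real.log y / Real.log 2 with ht
  have ht1 : 1 ≤ t := by
    rw [ht, one_le_div hl]
    exact Real.log_le_log two_pos (by linarith)
  have hsub : primesLT y ⊆ Nat.primesBelow (2 ^ (⌊t⌋₊ + 1)) := by
    intro p hp
    rw [mem_primesLT] at hp
    refine Nat.mem_primesBelow.2 ⟨?_, hp.1⟩
    have h1 : t < (⌊t⌋₊ + 1 : ℕ) := by exact_mod_cast Nat.lt_floor_add_one t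
    have h2 : y < (2 : ℝ) ^ (⌊t⌋₊ + 1) := by
      rw [← Real.log_lt_log_iff (by linarith) (by positivity), Real.log_pow]
      rwa [ht, div_lt_iff₀ hl] at h1
    exact_mod_cast hp.2.trans h2
  have hlog : Real.log t ≤ Real.log (Real.log y) + 1 := by
    rw [ht, Real.log_div (by positivity) hl.ne']
    have : -1 ≤ Real.log (Real.log 2) := by
      rw [Real.le_log_iff_exp_le hl]
      have h := Real.exp_neg_one_lt_d9
      have := Real.log_two_gt_d9
      linarith
    linarith
  calc ∑ p ∈ primesLT y, (p : ℝ)⁻¹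
      ≤ ∑ p ∈ Nat.primesBelow (2 ^ (⌊t⌋₊ + 1)), (p : ℝ)⁻¹ :=
        sum_le_sum_of_subset_of_nonneg hsub fun _ _ _ => by positivity
    _ ≤ 4 * (harmonic ⌊t⌋₊ : ℝ) := sum_inv_primesBelow_two_pow_le _
    _ ≤ 4 * (1 + Real.log t) := by gcongr; exact harmonic_floor_le_one_add_log t ht1
    _ ≤ 4 * Real.log (Real.log y) + 8 / c * c := by
        rw [div_mul_cancel₀ _ hc.ne']; linarith
    _ ≤ 4 * Real.log (Real.log y) + 8 / c * Real.log (Real.log y) := by gcongr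
    _ = _ := by ring

/-! ### Squarefree expansion and Rankin's bound -/

theorem pow_omegaBelow_eq_sum (z : ℂ) (y : ℝ) {n : ℕ} (hn : n ≠ 0) :
    z ^ omegaBelow y n =
      ∑ s ∈ (primesLT y).powerset, if (∏ p ∈ s, p) ∣ n then (z - 1) ^ s.card else 0 := by
  have h1 : z ^ omegaBelow y n =
      ∏ p ∈ primesLT y, (1 + if p ∣ n then z - 1 else 0) := by
    have : n.primeFactors.filter (fun p : ℕ => (p : ℝ) < y) = {p ∈ primesLT y | p ∣ n} := by
      ext p
      simp only [mem_filter, Nat.mem_primeFactors, mem_primesLT]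
      tauto
    rw [omegaBelow, this, ← prod_const, prod_filter]
    refine prod_congr rfl fun p _ => ?_
    split_ifs <;> simp
  rw [h1, prod_one_add]
  refine sum_congr rfl fun s hs => ?_
  have hs' : ∀ p ∈ s, p.Prime := fun p hp => ((mem_primesLT y p).1 (mem_powerset.1 hs hp)).1
  rw [prod_ite_zero, prod_const]
  refine if_congr ⟨fun h => ?_, fun h p hp => (dvd_prod_of_mem _ hp).trans h⟩ rfl rfl
  exact prod_primes_dvd n (fun p hp => (hs' p hp).prime) h

theorem omegaSum_eq (z : ℂ) (x y : ℝ) :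
    omegaSum z x y = ∑ s ∈ (primesLT y).powerset,
      (z - 1) ^ s.card * ((⌊x / ((∏ p ∈ s, p : ℕ) : ℝ)⌋₊ : ℕ) : ℂ) := by
  rw [omegaSum, sum_congr rfl fun n hn =>
    pow_omegaBelow_eq_sum z y (Nat.one_le_iff_ne_zero.1 (mem_Icc.1 hn).1), sum_comm]
  refine sum_congr rfl fun s _ => ?_
  rw [← sum_filter, sum_const, nsmul_eq_mul, mul_comm, Nat.floor_div_natCast]
  congr 2
  exact Nat.Ioc_filter_dvd_card_eq_div _ _

theorem omegaMain_eq (z : ℂ) (x y : ℝ) :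
    omegaMain z x y = ∑ s ∈ (primesLT y).powerset,
      (z - 1) ^ s.card * ((x / ((∏ p ∈ s, p : ℕ) : ℝ) : ℝ) : ℂ) := by
  rw [omegaMain, prod_one_add, mul_sum]
  refine sum_congr rfl fun s _ => ?_
  rw [prod_div_distrib, prod_const]
  push_cast
  ring

theorem abs_floor_sub_le_rpow {t σ : ℝ} (ht : 0 < t) (h0 : 0 ≤ σ) (h1 : σ ≤ 1) :
    |(⌊t⌋₊ : ℝ) - t| ≤ t ^ σ := by
  have hf := Nat.floor_le ht.le
  have hlt := Nat.lt_floor_add_one t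
  have hn : (0 : ℝ) ≤ ⌊t⌋₊ := Nat.cast_nonneg _
  rw [abs_sub_comm, abs_of_nonneg (by linarith)]
  rcases le_total 1 t with h | h
  · linarith [Real.one_le_rpow h h0]
  · have := Real.rpow_le_rpow_of_exponent_ge ht h h1
    rw [Real.rpow_one] at this
    linarith

theorem norm_omegaSum_sub_omegaMain_le_prod (z : ℂ) {x y σ : ℝ} (hx : 0 < x) (h0 : 0 ≤ σ)
    (h1 : σ ≤ 1) :
    ‖omegaSum z x y - omegaMain z x y‖ ≤
      x ^ σ * ∏ p ∈ primesLT y, (1 + ‖z - 1‖ * ((p : ℝ) ^ σ)⁻¹) := by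
  rw [omegaSum_eq, omegaMain_eq, ← sum_sub_distrib, prod_one_add, mul_sum]
  refine (norm_sum_le _ _).trans (sum_le_sum fun s hs => ?_)
  have hpos : (0 : ℝ) < (∏ p ∈ s, p : ℕ) := by
    exact_mod_cast prod_pos fun p hp =>
      ((mem_primesLT y p).1 (mem_powerset.1 hs hp)).1.pos
  rw [← mul_sub, norm_mul, norm_pow, ← Complex.ofReal_natCast, ← Complex.ofReal_sub,
    Complex.norm_real, Real.norm_eq_abs]
  refine (mul_le_mul_of_nonneg_left (abs_floor_sub_le_rpow (div_pos hx hpos) h0 h1)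
    (by positivity)).trans_eq ?_
  rw [prod_mul_distrib, prod_const, prod_inv_distrib,
    Real.finsetProd_rpow _ _ fun p _ => Nat.cast_nonneg p, Real.div_rpow hx.le hpos.le]
  push_cast
  ring

theorem norm_omegaSum_sub_omegaMain_le {A : ℝ}
    (hA : ∀ y : ℝ, 3 ≤ y → ∑ p ∈ primesLT y, (p : ℝ)⁻¹ ≤ A * Real.log (Real.log y))
    {R : ℝ} {z : ℂ} (hz : ‖z‖ ≤ R) {x y : ℝ} (hy : 3 ≤ y) (hyx : y ≤ x) :
    ‖omegaSum z x y - omegaMain z x y‖ ≤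
      x * Real.exp (-alphaParam x y) * Real.log x ^ (3 * (R + 1) * A) := by
  have hx : 0 < x := by linarith
  have hly := one_lt_log hy
  have hlx := one_lt_log (hy.trans hyx)
  have hR : ‖z - 1‖ ≤ R + 1 := (norm_sub_le z 1).trans (by simpa using hz)
  have hR0 : 0 ≤ R + 1 := (norm_nonneg _).trans hR
  -- This `σ` costs only `p ^ (1 / log y) ≤ e < 3` per prime `p < y`, yet saves `e ^ (-α)`.
  have hxσ : x ^ (1 - 1 / Real.log y) = x * Real.exp (-alphaParam x y) := by
    rw [Real.rpow_def_of_pos hx, alphaParam, mul_sub, mul_one, sub_eq_add_neg, Real.exp_add,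
      Real.exp_log hx, mul_one_div]
  have hp : ∀ p ∈ primesLT y, ‖z - 1‖ * ((p : ℝ) ^ (1 - 1 / Real.log y))⁻¹ ≤
      3 * (R + 1) * (p : ℝ)⁻¹ := by
    intro p hp
    obtain ⟨hp, hpy⟩ := (mem_primesLT y p).1 hp
    have hp0 : (0 : ℝ) < p := by exact_mod_cast hp.pos
    have : (p : ℝ) ^ (1 / Real.log y) ≤ 3 := by
      rw [Real.rpow_def_of_pos hp0, mul_one_div]
      refine (Real.exp_le_exp.2 ?_).trans Real.exp_one_lt_three.le
      rw [div_le_one (by linarith)]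
      exact Real.log_le_log hp0 hpy.le
    rw [Real.rpow_sub hp0, Real.rpow_one, inv_div, div_eq_mul_inv]
    calc _ ≤ (R + 1) * (3 * (p : ℝ)⁻¹) := by gcongr
      _ = _ := by ring
  have hprod : ∏ p ∈ primesLT y, (1 + ‖z - 1‖ * ((p : ℝ) ^ (1 - 1 / Real.log y))⁻¹) ≤
      Real.log x ^ (3 * (R + 1) * A) := by
    refine (Real.prod_one_add_le_exp_sum _ fun p => by positivity).trans ?_
    rw [Real.rpow_def_of_pos (by linarith)]
    refine Real.exp_le_exp.2 ((sum_le_sum hp).trans ?_)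
    rw [← mul_sum]
    calc _ ≤ 3 * (R + 1) * (A * Real.log (Real.log x)) := by
          refine mul_le_mul_of_nonneg_left ?_ (by positivity)
          refine (sum_le_sum_of_subset_of_nonneg ?_ fun _ _ _ => by positivity).trans
            (hA x (hy.trans hyx))
          intro p hp
          rw [mem_primesLT] at hp ⊢
          exact ⟨hp.1, hp.2.trans_le hyx⟩
      _ = _ := by ring
  refine (norm_omegaSum_sub_omegaMain_le_prod z hx (σ := 1 - 1 / Real.log y) ?_ ?_).trans ?_
  · rw [sub_nonneg, div_le_one (by linarith)]; exact hly.le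
  · have : 0 < 1 / Real.log y := by positivity
    linarith
  · rw [hxσ]
    gcongr

/-! ### Lower bound for the main term -/

theorem exp_neg_two_mul_le {t : ℝ} (h0 : 0 ≤ t) (h1 : t ≤ 1 / 2) :
    Real.exp (-(2 * t)) ≤ 1 - t := by
  rw [Real.exp_neg]
  refine inv_le_of_inv_le₀ (by linarith) ?_
  refine le_trans ?_ (Real.add_one_le_exp _)
  rw [inv_le_iff_one_le_mul₀ (by linarith)]
  nlinarith

theorem exists_le_norm_prod_one_add_div {w : ℂ} (hw : ∀ p : ℕ, p.Prime → 1 + w / (p : ℂ) ≠ 0) :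
    ∃ c : ℝ, 0 < c ∧ ∀ y : ℝ, c * Real.exp (-(2 * ‖w‖ * ∑ p ∈ primesLT y, (p : ℝ)⁻¹)) ≤
      ‖∏ p ∈ primesLT y, (1 + w / (p : ℂ))‖ := by
  -- Capping at 1 makes products of `m` decrease as primes are added; since `m p = 1` for `p ≥ 2 *
  -- ‖w‖`, one finite product bounds them all below.
  set m : ℕ → ℝ := fun p => min 1 (‖1 + w / (p : ℂ)‖ * Real.exp (2 * (‖w‖ * (p : ℝ)⁻¹)))
  have hm_pos : ∀ p : ℕ, p.Prime → 0 < m p := fun p hp =>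
    lt_min one_pos (mul_pos (norm_pos_iff.2 (hw p hp)) (Real.exp_pos _))
  have hm_one : ∀ p : ℕ, p.Prime → 2 * ‖w‖ ≤ p → m p = 1 := by
    intro p hp hpw
    have hp0 : (0 : ℝ) < p := by exact_mod_cast hp.pos
    refine min_eq_left ?_
    have ht : ‖w‖ * (p : ℝ)⁻¹ ≤ 1 / 2 := by
      rw [← div_eq_mul_inv, div_le_iff₀ hp0]; linarith
    have h1 := exp_neg_two_mul_le (by positivity) ht
    have h2 : 1 - ‖w‖ * (p : ℝ)⁻¹ ≤ ‖1 + w / (p : ℂ)‖ := by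
      have := norm_sub_norm_le (1 : ℂ) (-(w / (p : ℂ)))
      simpa [div_eq_mul_inv] using this
    rw [← div_le_iff₀ (Real.exp_pos _), one_div, ← Real.exp_neg]
    exact h1.trans h2
  refine ⟨∏ p ∈ primesLT (2 * ‖w‖), m p, prod_pos fun p hp =>
    hm_pos p ((mem_primesLT _ p).1 hp).1, fun y => ?_⟩
  have hle : ∏ p ∈ primesLT (2 * ‖w‖), m p ≤ ∏ p ∈ primesLT y, m p := by
    have hprime : ∀ p ∈ primesLT (2 * ‖w‖) ∪ primesLT y, p.Prime := by
      intro p hp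
      simp only [mem_union, mem_primesLT] at hp
      tauto
    calc _ = ∏ p ∈ primesLT (2 * ‖w‖) ∪ primesLT y, m p := by
          refine prod_subset subset_union_left fun p hp hpn => hm_one p (hprime p hp) ?_
          by_contra! h
          exact hpn ((mem_primesLT _ p).2 ⟨hprime p hp, h⟩)
      _ ≤ _ := prod_le_prod_of_subset_of_le_one subset_union_right
          (fun p hp => (hm_pos p (hprime p hp)).le) fun p _ _ => min_le_left _ _
  calc _ ≤ (∏ p ∈ primesLT y, m p) *
        Real.exp (-(2 * ‖w‖ * ∑ p ∈ primesLT y, (p : ℝ)⁻¹)) := by gcongr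
    _ = ∏ p ∈ primesLT y, (m p * Real.exp (-(2 * (‖w‖ * (p : ℝ)⁻¹)))) := by
        rw [prod_mul_distrib, ← Real.exp_sum, sum_neg_distrib, mul_sum]
        simp only [mul_assoc]
    _ ≤ ∏ p ∈ primesLT y, ‖1 + w / (p : ℂ)‖ := by
        refine prod_le_prod (fun p hp => ?_) fun p _ => ?_
        · exact mul_nonneg (hm_pos p ((mem_primesLT _ p).1 hp).1).le (Real.exp_pos _).le
        · rw [Real.exp_neg, ← div_eq_mul_inv, div_le_iff₀ (Real.exp_pos _)]
          exact min_le_right _ _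
    _ = _ := (norm_prod _ _).symm

theorem exists_le_norm_omegaMain {A : ℝ}
    (hA : ∀ y : ℝ, 3 ≤ y → ∑ p ∈ primesLT y, (p : ℝ)⁻¹ ≤ A * Real.log (Real.log y))
    (hA0 : 0 ≤ A) {R : ℝ} {z : ℂ} (hz : ‖z‖ ≤ R) (hzp : ∀ p : ℕ, p.Prime → z ≠ 1 - (p : ℂ)) :
    ∃ c : ℝ, 0 < c ∧ ∀ x y : ℝ, 3 ≤ y → y ≤ x →
      c * (x * Real.log x ^ (-(2 * (R + 1) * A))) ≤ ‖omegaMain z x y‖ := by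
  have hR : ‖z - 1‖ ≤ R + 1 := (norm_sub_le z 1).trans (by simpa using hz)
  have hR0 : 0 ≤ R + 1 := (norm_nonneg _).trans hR
  obtain ⟨c, hc, h⟩ := exists_le_norm_prod_one_add_div (w := z - 1) fun p hp h => by
    have hp0 : (p : ℂ) ≠ 0 := by exact_mod_cast hp.ne_zero
    field_simp at h
    exact hzp p hp (by linear_combination h)
  refine ⟨c, hc, fun x y hy hyx => ?_⟩
  have hx : 0 < x := by linarith
  have hly := one_lt_log hy
  have hlx := one_lt_log (hy.trans hyx)
  have hexp : Real.log x ^ (-(2 * (R + 1) * A)) ≤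
      Real.exp (-(2 * ‖z - 1‖ * ∑ p ∈ primesLT y, (p : ℝ)⁻¹)) := by
    rw [Real.rpow_def_of_pos (by linarith)]
    refine Real.exp_le_exp.2 ?_
    have hll : Real.log (Real.log y) ≤ Real.log (Real.log x) :=
      Real.log_le_log (by linarith) (Real.log_le_log (by linarith) hyx)
    have : 2 * ‖z - 1‖ * ∑ p ∈ primesLT y, (p : ℝ)⁻¹ ≤
        2 * (R + 1) * (A * Real.log (Real.log x)) := by
      gcongr
      exact (hA y hy).trans (by gcongr)
    linarith
  rw [omegaMain, norm_mul, Complex.norm_real, Real.norm_of_nonneg hx.le]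
  calc _ = x * (c * Real.log x ^ (-(2 * (R + 1) * A))) := by ring
    _ ≤ _ := by
      gcongr
      exact (mul_le_mul_of_nonneg_left hexp hc.le).trans (h y)

/-! ### Conclusion -/

theorem exp_neg_mul_rpow_le {l α B E : ℝ} (hl : 0 < l) (h : (B + E) * Real.log l ≤ α) :
    Real.exp (-α) * l ^ B ≤ l ^ (-E) := by
  rw [Real.rpow_def_of_pos hl, Real.rpow_def_of_pos hl, ← Real.exp_add]
  exact Real.exp_le_exp.2 (by linarith)

theorem theorem1 :
    ∃ C₁ : ℝ, 0 < C₁ ∧ ∀ R : ℝ, 0 < R → ∃ D : ℝ, 0 < D ∧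
      (∃ C₂ : ℝ, 0 < C₂ ∧ ∀ (z : ℂ) (x y : ℝ), ‖z‖ ≤ R → 3 ≤ y → y ≤ x →
        ‖omegaSum z x y - omegaMain z x y‖ ≤
          C₁ * (x * Real.exp (-alphaParam x y) * Real.log x ^ D) +
            C₂ * (x / Real.log x ^ (R + 2))) ∧
      (∀ ε : ℝ, 0 < ε → ∃ C₃ : ℝ, 0 < C₃ ∧ ∀ (z : ℂ) (x y : ℝ),
        ‖z‖ ≤ R → 3 ≤ y → y ≤ x →
        (R + D + 1 + ε) * Real.log (Real.log x) ≤ alphaParam x y →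
        ‖omegaSum z x y - omegaMain z x y‖ ≤ C₃ * (x / Real.log y ^ (R + 1 + ε))) ∧
      (∃ K : ℝ, 0 < K ∧ ∀ z : ℂ, ‖z‖ ≤ R → z ≠ 1 →
        (∀ p : ℕ, p.Prime → z ≠ 1 - (p : ℂ)) →
        Asymptotics.IsEquivalent
          (Filter.comap (Prod.fst : ℝ × ℝ → ℝ) Filter.atTop ⊓
            Filter.principal {q : ℝ × ℝ | 3 ≤ q.2 ∧ q.2 ≤ q.1 ∧
              K * Real.log (Real.log q.1) ≤ alphaParam q.1 q.2})
          (fun q : ℝ × ℝ => omegaSum z q.1 q.2)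
          (fun q : ℝ × ℝ => omegaMain z q.1 q.2)) := by

  obtain ⟨A, hA0, hA⟩ := exists_sum_inv_primesLT_le
  refine ⟨1, one_pos, fun R hR => ⟨3 * (R + 1) * A, by positivity, ⟨1, one_pos, ?_⟩, ?_, ?_⟩⟩
  · intro z x y hz hy hyx
    have hlx := one_lt_log (hy.trans hyx)
    have hx : 0 < x := by linarith
    have := norm_omegaSum_sub_omegaMain_le hA hz hy hyx
    have : 0 ≤ x / Real.log x ^ (R + 2) := by positivity
    linarith
  · intro ε hε
    refine ⟨1, one_pos, fun z x y hz hy hyx hα => ?_⟩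
    have hly := one_lt_log hy
    have hlx := one_lt_log (hy.trans hyx)
    have hx : 0 < x := by linarith
    refine (norm_omegaSum_sub_omegaMain_le hA hz hy hyx).trans ?_
    rw [one_mul, mul_assoc, div_eq_mul_inv, ← Real.rpow_neg (by linarith)]
    gcongr
    refine (exp_neg_mul_rpow_le (E := R + 1 + ε) (by linarith) ?_).trans ?_
    · exact le_of_eq_of_le (by ring) hα
    · exact Real.rpow_le_rpow_of_nonpos (by linarith)
        (Real.log_le_log (by linarith) hyx) (by linarith)
  -- The first summand cancels the power of `log x` in the error, the second matches the lower bound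
  -- for the main term, and the extra 1 leaves a factor `1 / log x`.
  · refine ⟨3 * (R + 1) * A + (2 * (R + 1) * A + 1), by positivity, fun z hz _ hzp => ?_⟩
    obtain ⟨c, hc, hM⟩ := exists_le_norm_omegaMain hA hA0.le hz hzp
    refine isLittleO_iff.2 fun δ hδ => ?_
    have hlarge : ∀ᶠ x : ℝ in atTop, (c * δ)⁻¹ ≤ Real.log x :=
      Real.tendsto_log_atTop.eventually_ge_atTop _
    rw [eventually_inf_principal]
    filter_upwards [hlarge.comap Prod.fst] with ⟨x, y⟩ hxl ⟨hy, hyx, hα⟩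
    simp only at hxl hy hyx hα
    have hlx := one_lt_log (hy.trans hyx)
    have hx : 0 < x := by linarith
    have hinv : (Real.log x)⁻¹ ≤ c * δ := inv_le_of_inv_le₀ (by positivity) hxl
    calc ‖omegaSum z x y - omegaMain z x y‖
        ≤ x * Real.exp (-alphaParam x y) * Real.log x ^ (3 * (R + 1) * A) :=
          norm_omegaSum_sub_omegaMain_le hA hz hy hyx
      _ ≤ x * Real.log x ^ (-(2 * (R + 1) * A + 1)) := by
          rw [mul_assoc]
          gcongr
          exact exp_neg_mul_rpow_le (by linarith) hα
      _ = x * Real.log x ^ (-(2 * (R + 1) * A)) * (Real.log x)⁻¹ := by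
          rw [neg_add, Real.rpow_add (by linarith), Real.rpow_neg_one]
          ring
      _ ≤ x * Real.log x ^ (-(2 * (R + 1) * A)) * (c * δ) := by gcongr
      _ = δ * (c * (x * Real.log x ^ (-(2 * (R + 1) * A)))) := by ring
      _ ≤ δ * ‖omegaMain z x y‖ := by gcongr; exact hM x y hy hyx
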